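/- Let $\mathbb{P}(\mathbb{Z})$ be the set of cyclic modules $\bar{\mathbf v}=\mathbb{Z}\mathbf v\subset\mathbb{Z}^2$ generated by unimodular pairs $\mathbf v$, and let $G$ be its distant graph: $\bar{\mathbf u}$ and $\bar{\mathbf v}$ are adjacent iff $\det[\mathbf u,\mathbf v]=\pm1$. Let $\bar{\mathbf x}\neq\bar{\mathbf y}$ be non-adjacent vertices. *Coding basis.* Choose generators $\mathbf x\in\bar{\mathbf x}$, $\mathbf y\in\bar{\mathbf y}$ with $\det[\mathbf x,\mathbf y]>0$. Among the vectors $\mathbf c$ with $\det[\mathbf x,\mathbf c]=1$ there is exactly one pair $\mathbf e_1$, $\mathbf f_1=\mathbf e_1-\mathbf x$ such that $\mathbf e_1$ lies in the first and $\mathbf f_1$ in the second quadrant of the axes directed by $\mathbf x$ (horizontal) and $\mathbf y$ (vertical). Write $\mathbf y=p\,\mathbf x+q\,\mathbf f_1$; if $q/p\ge 2$ the coding basis is $(\mathbf g,\mathbf h)=(\mathbf x,\mathbf f_1)$, otherwise it is $(\mathbf g,\mathbf h)=(-\mathbf x,\mathbf e_1)$. From now on $p,q$ denote the coordinates of $\mathbf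 y$ in the coding basis, $\mathbf y=p\,\mathbf g+q\,\mathbf h$ (so $q/p\ge2$), and $q/p=[d_0;d_1,\dots,d_n]$ is the continued fraction expansion with positive integers $d_i$ and $d_n>1$. *Coding of paths.* Let $E(a)=\begin{pmatrix}a&1\\-1&0\end{pmatrix}$. A path $\bar{\mathbf x}=v_0,v_1,\dots,v_m=\bar{\mathbf y}$ in $G$ is coded by the unique integers $a_1,\dots,a_m$ such that, for each $i$, in coordinates with respect to $(\mathbf g,\mathbf h)$, the vertex $v_i$ is generated by the row vector $(1,0)E(a_i)\cdots E(a_1)$. An element $M\in PGL(2,\mathbb{Z})$ (a matrix up to sign) *represents* the path if for any choice of $\mathbf x,\mathbf y$ as above the product $E(a_m)\cdots E(a_1)$ is equal to $M$ in $PGL(2,\mathbb{Z})$. Put $$A=E\big((-1)^{n+1}d_n\big)\cdots E(d_1)\,E(-d_0)\,E(0).$$ **Proposition.** Every shortest path from $\bar{\mathbf x}$ to $\bar{\mathbf y}$ is represented by an element of $PGL(2,\mathbb{Z})$. At most two elements of $PGL(2,\mathbb{Z})$ represent shortest paths from $\bar{\mathbf x}$ to $\bar{\mathbf y}$, and $A$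 is always one of them. All the shortest paths are represented by precisely one element iff 1. either $d_n>2$, or 2. $d_n-1=d_{n-1}=\dots=d_{n-k}=1$ and $d_{n-k-1}>1$ for some odd $k$ with $1\le k\le n-1$. If two elements represent shortest paths from $\bar{\mathbf x}$ to $\bar{\mathbf y}$, then the other one is $$-\begin{pmatrix}1&0\\(-1)^{n+1}&1\end{pmatrix}\cdot A .$$ -/

import Mathlib

/-! ### The projective line over the integers and its distant graph -/

/-- `v` is a unimodular pair and the point (cyclic module) `P` is generated by it. -/
def IsRep (v : Fin 2 → ℤ) (P : Submodule ℤ (Fin 2 → ℤ)) : Prop :=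
  IsCoprime (v 0) (v 1) ∧ P = Submodule.span ℤ {v}

/-- The projective line `ℙ(ℤ)`: cyclic submodules of `ℤ²` generated by unimodular pairs. -/
def ProjLine : Type :=
  {P : Submodule ℤ (Fin 2 → ℤ) // ∃ v, IsRep v P}

/-- The determinant of the matrix `[u, v]` with columns `u` and `v`. -/
def det2 (u v : Fin 2 → ℤ) : ℤ :=
  Matrix.det !![u 0, v 0; u 1, v 1]

/-- The distant relation: `[u, v]` is invertible for any choice of generators `u`, `v`. -/
def Distant (P Q : ProjLine) : Prop :=
  ∀ u v, IsRep u P.1 → IsRep v Q.1 → IsUnit (det2 u v)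

/-- The distant graph of the projective line over `ℤ`. -/
def distantGraph : SimpleGraph ProjLine where
  Adj := Distant
  symm := ⟨by
    intro P Q h u v hu hv
    have h1 := (h v u hv hu).neg
    have h2 : det2 u v = -det2 v u := by
      simp only [det2, Matrix.det_fin_two_of]; ring
    rwa [h2]⟩
  loopless := ⟨by
    intro P h
    obtain ⟨v, hv⟩ := P.2
    have h1 := h v v hv hv
    have h2 : det2 v v = 0 := by
      simp only [det2, Matrix.det_fin_two_of]; ring
    rw [h2] at h1
    exact not_isUnit_zero h1⟩

/-- A walk between two vertices that has as few edges as possible. -/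
def IsShortest {P Q : ProjLine} (w : distantGraph.Walk P Q) : Prop :=
  w.length = distantGraph.dist P Q

/-! ### The basis in which paths are coded -/

/-- The closed first quadrant of the axes directed by `x` (horizontal) and `y` (vertical). -/
def FirstQuadrant (x y v : Fin 2 → ℤ) : Prop :=
  ∃ α β : ℝ, 0 ≤ α ∧ 0 ≤ β ∧ ∀ i, (v i : ℝ) = α * x i + β * y i

/-- The closed second quadrant of the axes directed by `x` (horizontal) and `y` (vertical). -/
def SecondQuadrant (x y v : Fin 2 → ℤ) : Prop :=
  ∃ α β : ℝ, α ≤ 0 ∧ 0 ≤ β ∧ ∀ i, (v i : ℝ) = α * x i + β * y i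

/-- `(e, f)` is the first basis `(e₁, f₁)` of the transition algorithm for `x` and `y`: two
consecutive vectors `e`, `f = e - x` of the sequence of all `c` with `det [x, c] = 1`, the first
one in the first quadrant and the second one in the second quadrant. -/
def IsFirstBasis (x y e f : Fin 2 → ℤ) : Prop :=
  det2 x e = 1 ∧ f = e - x ∧ FirstQuadrant x y e ∧ SecondQuadrant x y f

/-- `(g, h)` is the basis of `ℤ²` used to code the paths from `ℤx` to `ℤy`. Write
`y = p x + q f₁`. The basis is `(x, f₁)` if `y` has slope `q / p ≥ 2` in it, and `(-x, e₁)`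
otherwise. -/
def IsCodingBasis (x y g h : Fin 2 → ℤ) : Prop :=
  ∃ e f, IsFirstBasis x y e f ∧
    ∃ p q : ℤ, y = p • x + q • f ∧
      (2 ≤ (q : ℚ) / p ∧ g = x ∧ h = f ∨ (q : ℚ) / p < 2 ∧ g = -x ∧ h = e)

/-- `(x, y)` is an admissible choice of generators of the points `P` and `Q` (positively oriented,
so that the vectors `c` with `det [x, c] = 1` lie on the same side of `ℤx` as `y`), and `(g, h)` is
the coding basis for this choice. -/
def IsFrame (P Q : ProjLine) (x y g h : Fin 2 → ℤ) : Prop :=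
  IsRep x P.1 ∧ IsRep y Q.1 ∧ 0 < det2 x y ∧ IsCodingBasis x y g h

/-! ### Coding of paths by products of matrices -/

/-- The elementary matrix `E(a)`. -/
def E (a : ℤ) : Matrix.SpecialLinearGroup (Fin 2) ℤ :=
  ⟨!![a, 1; -1, 0], by simp [Matrix.det_fin_two_of]⟩

/-- The product `E(a_{m-1}) ⋯ E(a_1) E(a_0)`. -/
def prodE (a : ℕ → ℤ) : ℕ → Matrix.SpecialLinearGroup (Fin 2) ℤ
  | 0 => 1
  | m + 1 => E (a m) * prodE a m

/-- The class in `PGL(2, ℤ)` of a matrix of determinant one. -/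
def toPGL (M : Matrix.SpecialLinearGroup (Fin 2) ℤ) : Matrix.ProjGenLinGroup (Fin 2) ℤ :=
  Matrix.ProjGenLinGroup.mk (M : Matrix.GeneralLinearGroup (Fin 2) ℤ)

/-- The Blunck–Havlicek coding: in coordinates with respect to the basis `(g, h)`, the vertex with
number `i` of the path `w` is generated by the row vector `(1, 0) E(a_{i-1}) ⋯ E(a_0)`. -/
def IsCode {P Q : ProjLine} (g h : Fin 2 → ℤ) (w : distantGraph.Walk P Q) (a : ℕ → ℤ) : Prop :=
  ∀ i ≤ w.length,
    (w.getVert i).1 = Submodule.span ℤ {prodE a i 0 0 • g + prodE a i 0 1 • h}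

/-- The element `M` of `PGL(2, ℤ)` represents the path `w`: for any choice of generators of the
ends, the product coding `w` in the corresponding basis is equal to `M`. -/
def Represents {P Q : ProjLine} (w : distantGraph.Walk P Q)
    (M : Matrix.ProjGenLinGroup (Fin 2) ℤ) : Prop :=
  ∀ x y g h, IsFrame P Q x y g h → ∃ a, IsCode g h w a ∧ toPGL (prodE a w.length) = M

/-- The elements of `PGL(2, ℤ)` that represent shortest paths from `P` to `Q`. -/
def representingMatrices (P Q : ProjLine) : Set (Matrix.ProjGenLinGroup (Fin 2) ℤ) :=
  {M | ∃ w : distantGraph.Walk P Q, IsShortest w ∧ Represents w M}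

/-! ### Continued fractions -/

/-- The value of the finite continued fraction `[d_0; d_1, …, d_n]`. -/
def cfVal : ℕ → (ℕ → ℕ) → ℚ
  | 0, d => d 0
  | n + 1, d => d 0 + 1 / cfVal n (fun i => d (i + 1))

/-- `[d_0; d_1, …, d_n]`, with positive `d_1, …, d_n` and `d_n > 1`, is the continued fraction
expansion of the slope `q / p` of `y = p g + q h` in the coding basis `(g, h)`. -/
def IsSlopeExpansion (P Q : ProjLine) (n : ℕ) (d : ℕ → ℕ) : Prop :=
  (∀ i, 1 ≤ i → i ≤ n → 0 < d i) ∧ 1 < d n ∧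
    ∃ x y g h, IsFrame P Q x y g h ∧
      ∃ p q : ℤ, y = p • g + q • h ∧ cfVal n d = (q : ℚ) / p

/-- The arguments `0, -d_0, d_1, -d_2, …` of the factors of the standard product. -/
def standardCode (d : ℕ → ℕ) : ℕ → ℤ
  | 0 => 0
  | i + 1 => (-1) ^ (i + 1) * (d i : ℤ)

/-- The matrix `A = E((-1)^(n+1) d_n) ⋯ E(d_1) E(-d_0) E(0)`. -/
def standardMatrix (n : ℕ) (d : ℕ → ℕ) : Matrix.SpecialLinearGroup (Fin 2) ℤ :=
  prodE (standardCode d) (n + 2)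

/-- The matrix with rows `(1, 0)` and `(c, 1)`. -/
def lowerShear (c : ℤ) : Matrix.SpecialLinearGroup (Fin 2) ℤ :=
  ⟨!![1, 0; c, 1], by simp [Matrix.det_fin_two_of]⟩

/-!
In the coding basis, the product `M` coding a path has first row a generator of the end `Q` and
second row a generator of the vertex before `Q` (`IsCode.isRep_one`), and up to sign a matrix of
determinant one is determined by the points that its rows generate (`toPGL_eq_of_isRep`). The
coding basis is unique up to a common sign (`IsFrame.eq_or_eq_neg`). So the elements of `PGL(2, ℤ)`
representing shortest paths correspond to the vertices through which such paths enter `Q`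
(`represents_toPGL_iff`).

Write the generator of `Q` as `l + r` with `det [l, r] = ±1`, where `l` is the convergent before the
last one and `r` the last intermediate convergent, `[d_0; …, d_n - 1]`. The edge between the two
parents `ℤl` and `ℤr` separates the points in the open cone of `l` and `r`, `Q` among them, from
the start `P` (`mem_support_of_leaves_cone`). So every shortest path passes through a parent, and
it must do so in the step before `Q` (`getVert_eq_or_of_isShortest`). Hence there are at most two
representing elements; they are `A`, for `ℤl`, and its product with a shear, for `ℤr`
(`rowVec_prodE_standardCode`).

Which parents occur is a question of their distances from `P`. By the same separation, the distance
to a mediant is one more than the smaller of the distances to its parents (`dist_add_eq`). Along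
the intermediate convergents this gives the distances `D_i` to the convergents `c_i`: the distance
`D_{i+2}` is `D_i + 1` if `d_i = 1` and `D_{i+1} + 1` otherwise (`IsIntermediate.dist_eq`). So `ℤl`
is never farther from `P` than `ℤr`, and they are equally far exactly if `d_n = 2` and the distance
grew at the last convergent before `Q`. It fails to grow there exactly if an odd number of partial
quotients equal to one stands before `d_n` (`succ_eq_iff_odd_trailing_ones`).
-/

/-! ### Generators of points and determinants -/

lemma det2_apply (u v : Fin 2 → ℤ) : det2 u v = u 0 * v 1 - v 0 * u 1 := by
  simp only [det2, Matrix.det_fin_two_of]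

lemma det2_comb (l r : Fin 2 → ℤ) (a b c d : ℤ) :
    det2 (a • l + b • r) (c • l + d • r) = (a * d - b * c) * det2 l r := by
  simp only [det2_apply, Pi.add_apply, Pi.smul_apply, smul_eq_mul]; ring

lemma eq_or_eq_neg_of_det2_eq_zero {u v : Fin 2 → ℤ} (hu : IsCoprime (u 0) (u 1))
    (hv : IsCoprime (v 0) (v 1)) (h : det2 u v = 0) : v = u ∨ v = -u := by
  obtain ⟨a, b, hab⟩ := hu
  obtain ⟨c, d, hcd⟩ := hv
  rw [det2_apply] at h
  have h0 : v 0 = (a * v 0 + b * v 1) * u 0 := by linear_combination (-v 0) * hab - b * h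
  have h1 : v 1 = (a * v 0 + b * v 1) * u 1 := by linear_combination (-v 1) * hab + a * h
  have hk : (a * v 0 + b * v 1) * (c * u 0 + d * u 1) = 1 := by
    linear_combination hcd - c * h0 - d * h1
  rcases Int.eq_one_or_neg_one_of_mul_eq_one hk with hk | hk <;> rw [hk] at h0 h1
  · left; ext i; fin_cases i <;> simp_all
  · right; ext i; fin_cases i <;> simp_all

lemma IsRep.neg {u : Fin 2 → ℤ} {P : Submodule ℤ (Fin 2 → ℤ)} (hu : IsRep u P) :
    IsRep (-u) P := by
  refine ⟨hu.1.neg_neg, ?_⟩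
  rw [hu.2, ← Set.neg_singleton, Submodule.span_neg]

lemma IsRep.eq_or_eq_neg {u v : Fin 2 → ℤ} {P : Submodule ℤ (Fin 2 → ℤ)} (hu : IsRep u P)
    (hv : IsRep v P) : v = u ∨ v = -u := by
  have h : v ∈ Submodule.span ℤ {u} := by
    rw [← hu.2, hv.2]; exact Submodule.mem_span_singleton_self v
  obtain ⟨k, rfl⟩ := Submodule.mem_span_singleton.1 h
  refine eq_or_eq_neg_of_det2_eq_zero hu.1 hv.1 ?_
  simp only [det2_apply, Pi.smul_apply, smul_eq_mul]; ring

lemma ProjLine.eq_of_isRep {u : Fin 2 → ℤ} {P Q : ProjLine} (hP : IsRep u P.1)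
    (hQ : IsRep u Q.1) : P = Q :=
  Subtype.ext (hP.2.trans hQ.2.symm)

lemma isCoprime_of_isUnit_det2 {u v : Fin 2 → ℤ} (h : IsUnit (det2 u v)) :
    IsCoprime (u 0) (u 1) := by
  rw [det2_apply, Int.isUnit_iff] at h
  rcases h with h | h
  · exact ⟨v 1, -v 0, by linear_combination h⟩
  · exact ⟨-v 1, v 0, by linear_combination -h⟩

lemma exists_isRep_of_isUnit_det2 {u v : Fin 2 → ℤ} (h : IsUnit (det2 u v)) :
    ∃ V : ProjLine, IsRep u V.1 :=
  have h' : IsRep u (Submodule.span ℤ {u}) := ⟨isCoprime_of_isUnit_det2 h, rfl⟩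
  ⟨⟨_, u, h'⟩, h'⟩

lemma distant_iff {u v : Fin 2 → ℤ} {P Q : ProjLine} (hu : IsRep u P.1) (hv : IsRep v Q.1) :
    Distant P Q ↔ IsUnit (det2 u v) := by
  refine ⟨fun h => h u v hu hv, fun h u' v' hu' hv' => ?_⟩
  have h1 : det2 (-u) v = -det2 u v := by simp only [det2_apply, Pi.neg_apply]; ring
  have h2 : det2 u (-v) = -det2 u v := by simp only [det2_apply, Pi.neg_apply]; ring
  have h3 : det2 (-u) (-v) = det2 u v := by simp only [det2_apply, Pi.neg_apply]; ring
  rcases hu.eq_or_eq_neg hu' with rfl | rfl <;> rcases hv.eq_or_eq_neg hv' with rfl | rfl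
  · exact h
  · rw [h2]; exact h.neg
  · rw [h1]; exact h.neg
  · rwa [h3]

lemma exists_comb {l r : Fin 2 → ℤ} (h : IsUnit (det2 l r)) (v : Fin 2 → ℤ) :
    ∃ α β : ℤ, v = α • l + β • r := by
  rw [Int.isUnit_iff, det2_apply] at h
  rcases h with h | h
  · refine ⟨det2 v r, det2 l v, ?_⟩
    ext i
    fin_cases i <;> simp [det2_apply]
    · linear_combination (-v 0) * h
    · linear_combination (-v 1) * h
  · refine ⟨-det2 v r, -det2 l v, ?_⟩
    ext i
    fin_cases i <;> simp [det2_apply]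
    · linear_combination (v 0) * h
    · linear_combination (v 1) * h

lemma comb_inj {l r : Fin 2 → ℤ} (h : det2 l r ≠ 0) {a b c d : ℤ}
    (hv : a • l + b • r = c • l + d • r) : a = c ∧ b = d := by
  have h1 : det2 (a • l + b • r) r = det2 (c • l + d • r) r := by rw [hv]
  have h2 : det2 l (a • l + b • r) = det2 l (c • l + d • r) := by rw [hv]
  simp only [det2_apply, Pi.add_apply, Pi.smul_apply, smul_eq_mul] at h h1 h2
  constructor <;> apply mul_right_cancel₀ h
  · linear_combination h1
  · linear_combination h2

/-! ### Separation of the distant graph by an edge -/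

/-- The points generated by the vectors `α l + β r` with `α, β > 0` are separated from all other
points by the edge `{ℤl, ℤr}`: a walk leaving this set passes through `ℤl` or `ℤr`. -/
lemma mem_support_of_leaves_cone {l r : Fin 2 → ℤ} (hlr : IsUnit (det2 l r)) {L R P : ProjLine}
    (hL : IsRep l L.1) (hR : IsRep r R.1)
    (hP : ∀ α β : ℤ, 0 < α → 0 < β → ¬ IsRep (α • l + β • r) P.1) {X : ProjLine}
    (w : distantGraph.Walk X P) {α β : ℤ} (hα : 0 < α) (hβ : 0 < β)
    (hX : IsRep (α • l + β • r) X.1) : L ∈ w.support ∨ R ∈ w.support := by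
  induction w generalizing α β with
  | nil => exact absurd hX (hP α β hα hβ)
  | @cons X Y P hXY w ih =>
    suffices h : L = Y ∨ R = Y ∨ ∃ α' β' : ℤ, 0 < α' ∧ 0 < β' ∧ IsRep (α' • l + β' • r) Y.1 by
      rcases h with rfl | rfl | ⟨α', β', hα', hβ', hY⟩
      · left; simp
      · right; simp
      · rcases ih hP hα' hβ' hY with h | h
        · left; simp [h]
        · right; simp [h]
    obtain ⟨y, hy⟩ := Y.2
    obtain ⟨γ, δ, rfl⟩ := exists_comb hlr y
    have hdet : IsUnit (det2 (α • l + β • r) (γ • l + δ • r)) := hXY _ _ hX hy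
    rw [det2_comb] at hdet
    have hdet' := isUnit_of_mul_isUnit_left hdet
    have hneg : -(γ • l + δ • r) = (-γ) • l + (-δ) • r := by module
    rw [Int.isUnit_iff] at hdet'
    rcases lt_trichotomy γ 0 with hγ | rfl | hγ
    · rcases lt_or_ge δ 0 with hδ | hδ
      · exact Or.inr (Or.inr ⟨-γ, -δ, by omega, by omega, hneg ▸ hy.neg⟩)
      · have h1 : δ = 0 := by
          by_contra h
          have : 0 < δ := by omega
          rcases hdet' with h' | h' <;> nlinarith [mul_pos hα this, mul_pos hβ (neg_pos.2 hγ)]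
        subst h1
        have h2 : γ = -1 := by
          rcases hdet' with h' | h' <;> nlinarith
        subst h2
        left
        refine ProjLine.eq_of_isRep hL ?_
        have := hy.neg
        rw [hneg] at this
        simpa using this
    · have h1 : δ = 1 ∨ δ = -1 := by
        rcases hdet' with h' | h'
        · exact Int.eq_one_or_neg_one_of_mul_eq_one (by linarith : δ * α = 1)
        · rcases Int.eq_one_or_neg_one_of_mul_eq_one (by linarith : (-δ) * α = 1) with h | h <;>
            omega
      right; left
      refine ProjLine.eq_of_isRep hR ?_
      rcases h1 with rfl | rfl
      · simpa using hy
      · have := hy.neg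
        simpa using this
    · rcases lt_or_ge 0 δ with hδ | hδ
      · exact Or.inr (Or.inr ⟨γ, δ, hγ, hδ, hy⟩)
      · have h1 : δ = 0 := by
          by_contra h
          have : 0 < -δ := by omega
          rcases hdet' with h' | h' <;> nlinarith [mul_pos hα this, mul_pos hβ hγ]
        subst h1
        have h2 : γ = 1 := by
          rcases hdet' with h' | h' <;> nlinarith
        subst h2
        left
        refine ProjLine.eq_of_isRep hL ?_
        simpa using hy

section Mediant

variable {l r : Fin 2 → ℤ} {L R U P : ProjLine}

lemma adj_add_left (hlr : IsUnit (det2 l r)) (hL : IsRep l L.1) (hU : IsRep (l + r) U.1) :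
    distantGraph.Adj L U := by
  refine (distant_iff hL hU).2 ?_
  have : det2 l (l + r) = det2 l r := by simp only [det2_apply, Pi.add_apply]; ring
  rwa [this]

lemma adj_add_right (hlr : IsUnit (det2 l r)) (hR : IsRep r R.1) (hU : IsRep (l + r) U.1) :
    distantGraph.Adj R U := by
  refine (distant_iff hR hU).2 ?_
  have : det2 r (l + r) = -det2 l r := by simp only [det2_apply, Pi.add_apply]; ring
  rw [this]; exact hlr.neg

/-- On a shortest path, a neighbour of the end can only be the vertex before it. -/
lemma getVert_eq_of_mem_support {w : distantGraph.Walk P U} (hw : IsShortest w)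
    (hLU : distantGraph.Adj L U) (h : L ∈ w.support) : w.getVert (w.length - 1) = L := by
  obtain ⟨i, hi, hil⟩ := SimpleGraph.Walk.mem_support_iff_exists_getVert.1 h
  have hne : i ≠ w.length := by
    rintro rfl
    rw [w.getVert_length] at hi
    exact hLU.ne hi.symm
  have hlen : w.length ≤ i + 1 := by
    have h1 := SimpleGraph.dist_le (((w.take i).copy rfl hi).concat hLU)
    rw [SimpleGraph.Walk.length_concat, SimpleGraph.Walk.length_copy,
      SimpleGraph.Walk.take_length] at h1
    rw [hw]; omega
  rw [show w.length - 1 = i by omega, hi]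

/-- If `P` is not in the open cone spanned by `l` and `r`, then a shortest path from `P` to
the mediant `l + r` enters it through one of the parents `l`, `r`. -/
lemma getVert_eq_or_of_isShortest (hlr : IsUnit (det2 l r)) (hL : IsRep l L.1)
    (hR : IsRep r R.1) (hU : IsRep (l + r) U.1)
    (hP : ∀ α β : ℤ, 0 < α → 0 < β → ¬ IsRep (α • l + β • r) P.1)
    {w : distantGraph.Walk P U} (hw : IsShortest w) :
    w.getVert (w.length - 1) = L ∨ w.getVert (w.length - 1) = R := by
  have h := mem_support_of_leaves_cone hlr hL hR hP w.reverse one_pos one_pos (by simpa using hU)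
  rw [SimpleGraph.Walk.support_reverse, List.mem_reverse, List.mem_reverse] at h
  exact h.imp (getVert_eq_of_mem_support hw (adj_add_left hlr hL hU))
    (getVert_eq_of_mem_support hw (adj_add_right hlr hR hU))

/-- Some shortest path from `P` enters `U` through its neighbour `L` if and only if `L` is closer to
`P` than `U`. -/
lemma exists_isShortest_through_iff (hLU : distantGraph.Adj L U) (hP : P ≠ U)
    (hr : distantGraph.Reachable P L) :
    (∃ w : distantGraph.Walk P U, IsShortest w ∧ w.getVert (w.length - 1) = L) ↔
      distantGraph.dist P U = distantGraph.dist P L + 1 := by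
  have hle : distantGraph.dist P U ≤ distantGraph.dist P L + 1 := by
    obtain ⟨w, hw⟩ := hr.exists_walk_length_eq_dist
    have h := SimpleGraph.dist_le (w.concat hLU)
    rwa [SimpleGraph.Walk.length_concat, hw] at h
  constructor
  · rintro ⟨w, hw, hwL⟩
    have h1 := SimpleGraph.dist_le ((w.take (w.length - 1)).copy rfl hwL)
    rw [SimpleGraph.Walk.length_copy, SimpleGraph.Walk.take_length] at h1
    have h2 : w.length ≠ 0 := fun h => hP (SimpleGraph.Walk.eq_of_length_eq_zero h)
    have h3 : w.length = _ := hw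
    omega
  · intro h
    obtain ⟨w, hw⟩ := hr.exists_walk_length_eq_dist
    refine ⟨w.concat hLU, ?_, ?_⟩
    · rw [IsShortest, SimpleGraph.Walk.length_concat, hw, h]
    · exact w.penultimate_concat hLU

lemma dist_add_eq (hlr : IsUnit (det2 l r)) (hL : IsRep l L.1)
    (hR : IsRep r R.1) (hU : IsRep (l + r) U.1)
    (hP : ∀ α β : ℤ, 0 < α → 0 < β → ¬ IsRep (α • l + β • r) P.1)
    (hr : distantGraph.Reachable P L) :
    distantGraph.dist P U = 1 + min (distantGraph.dist P L) (distantGraph.dist P R) := by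
  have hLU := adj_add_left hlr hL hU
  have hRU := adj_add_right hlr hR hU
  have hrU : distantGraph.Reachable P U := hr.trans hLU.reachable
  have hrR : distantGraph.Reachable P R := hrU.trans hRU.reachable.symm
  have hPU : P ≠ U := by rintro rfl; exact hP 1 1 one_pos one_pos (by simpa using hU)
  have h1L := hr.dist_triangle_left U
  have h1R := hrR.dist_triangle_left U
  rw [SimpleGraph.dist_eq_one_iff_adj.2 hLU] at h1L
  rw [SimpleGraph.dist_eq_one_iff_adj.2 hRU] at h1R
  obtain ⟨w, hw⟩ := hrU.exists_walk_length_eq_dist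
  rcases getVert_eq_or_of_isShortest hlr hL hR hU hP hw with h | h
  · have := (exists_isShortest_through_iff hLU hPU hr).1 ⟨w, hw, h⟩
    omega
  · have := (exists_isShortest_through_iff hRU hPU hrR).1 ⟨w, hw, h⟩
    omega

end Mediant

/-! ### Coding of walks -/

/-- The vector whose coordinates with respect to `(g, h)` are the row of `M` with index `i`. -/
def rowVec (g h : Fin 2 → ℤ) (M : Matrix.SpecialLinearGroup (Fin 2) ℤ) (i : Fin 2) : Fin 2 → ℤ :=
  M i 0 • g + M i 1 • h

section RowVec

variable {g h : Fin 2 → ℤ} {M N : Matrix.SpecialLinearGroup (Fin 2) ℤ}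

lemma det2_rowVec (g h : Fin 2 → ℤ) (M : Matrix.SpecialLinearGroup (Fin 2) ℤ) :
    det2 (rowVec g h M 0) (rowVec g h M 1) = det2 g h := by
  have h1 := M.det_coe
  rw [Matrix.det_fin_two] at h1
  rw [rowVec, rowVec, det2_comb, h1, one_mul]

lemma rowVec_E_mul_zero (g h : Fin 2 → ℤ) (a : ℤ) (M : Matrix.SpecialLinearGroup (Fin 2) ℤ) :
    rowVec g h (E a * M) 0 = a • rowVec g h M 0 + rowVec g h M 1 := by
  have h0 (j : Fin 2) : (E a * M) 0 j = a * M 0 j + M 1 j := by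
    rw [Matrix.SpecialLinearGroup.coe_mul, Matrix.mul_apply]; simp [E, Fin.sum_univ_two]
  rw [rowVec, h0, h0, rowVec, rowVec]; module

lemma rowVec_E_mul_one (g h : Fin 2 → ℤ) (a : ℤ) (M : Matrix.SpecialLinearGroup (Fin 2) ℤ) :
    rowVec g h (E a * M) 1 = -rowVec g h M 0 := by
  have h0 (j : Fin 2) : (E a * M) 1 j = -M 0 j := by
    rw [Matrix.SpecialLinearGroup.coe_mul, Matrix.mul_apply]; simp [E, Fin.sum_univ_two]
  rw [rowVec, h0, h0, rowVec]; module

lemma rowVec_one_zero (g h : Fin 2 → ℤ) : rowVec g h 1 0 = g := by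
  simp [rowVec]

lemma rowVec_one_one (g h : Fin 2 → ℤ) : rowVec g h 1 1 = h := by
  simp [rowVec]

lemma rowVec_neg (g h : Fin 2 → ℤ) (M : Matrix.SpecialLinearGroup (Fin 2) ℤ) (i : Fin 2) :
    rowVec g h (-M) i = -rowVec g h M i := by
  simp only [rowVec, Matrix.SpecialLinearGroup.coe_neg, Matrix.neg_apply]; module

lemma rowVec_lowerShear_mul_zero (g h : Fin 2 → ℤ) (c : ℤ)
    (M : Matrix.SpecialLinearGroup (Fin 2) ℤ) :
    rowVec g h (lowerShear c * M) 0 = rowVec g h M 0 := by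
  have h0 (j : Fin 2) : (lowerShear c * M) 0 j = M 0 j := by
    rw [Matrix.SpecialLinearGroup.coe_mul, Matrix.mul_apply]; simp [lowerShear, Fin.sum_univ_two]
  rw [rowVec, h0, h0, rowVec]

lemma rowVec_lowerShear_mul_one (g h : Fin 2 → ℤ) (c : ℤ)
    (M : Matrix.SpecialLinearGroup (Fin 2) ℤ) :
    rowVec g h (lowerShear c * M) 1 = c • rowVec g h M 0 + rowVec g h M 1 := by
  have h0 (j : Fin 2) : (lowerShear c * M) 1 j = c * M 0 j + M 1 j := by
    rw [Matrix.SpecialLinearGroup.coe_mul, Matrix.mul_apply]; simp [lowerShear, Fin.sum_univ_two]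
  rw [rowVec, h0, h0, rowVec, rowVec]; module

lemma rowVec_injective (hgh : IsUnit (det2 g h))
    (H : ∀ i, rowVec g h M i = rowVec g h N i) : M = N := by
  ext i j
  have h1 := comb_inj hgh.ne_zero (H i)
  fin_cases j
  · exact h1.1
  · exact h1.2

lemma toPGL_eq_iff : toPGL M = toPGL N ↔ N = M ∨ N = -M := by
  rw [toPGL, toPGL, Matrix.ProjGenLinGroup.mk_eq_mk_iff]
  constructor
  · rintro ⟨u, hu⟩
    have h1 (i j : Fin 2) : M i j * (u : ℤ) = N i j := by
      rw [← Matrix.mul_diagonal (fun _ => (u : ℤ)) M.1 i j]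
      exact congrArg (fun A : Matrix.GeneralLinearGroup (Fin 2) ℤ => A i j) hu
    rcases Int.units_eq_one_or u with rfl | rfl
    · left; ext i j; rw [← h1]; simp
    · right; ext i j; rw [← h1]; simp
  · rintro (rfl | rfl)
    · exact ⟨1, by simp⟩
    · refine ⟨-1, ?_⟩
      ext i j
      simp

/-- Up to sign, a matrix of determinant one is determined by the points generated by its rows:
the signs of the two rows agree because the determinants do. -/
lemma toPGL_eq_of_isRep (hgh : IsUnit (det2 g h)) {Q V : ProjLine}
    (hM : IsRep (rowVec g h M 0) Q.1) (hN : IsRep (rowVec g h N 0) Q.1)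
    (hM' : IsRep (rowVec g h M 1) V.1) (hN' : IsRep (rowVec g h N 1) V.1) :
    toPGL M = toPGL N := by
  rw [toPGL_eq_iff]
  have hdM := det2_rowVec g h M
  have hdN := det2_rowVec g h N
  have hne := hgh.ne_zero
  rcases hM.eq_or_eq_neg hN with h0 | h0 <;> rcases hM'.eq_or_eq_neg hN' with h1 | h1
  · exact Or.inl (rowVec_injective hgh (Fin.forall_fin_two.2 ⟨h0, h1⟩))
  · rw [h0, h1] at hdN
    simp only [det2_apply, Pi.neg_apply] at hdM hdN hne
    exact absurd (by linarith) hne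
  · rw [h0, h1] at hdN
    simp only [det2_apply, Pi.neg_apply] at hdM hdN hne
    exact absurd (by linarith) hne
  · exact Or.inr (rowVec_injective hgh
      (Fin.forall_fin_two.2 ⟨by rw [h0, rowVec_neg], by rw [h1, rowVec_neg]⟩))

lemma IsRep.rowVec_of_toPGL_eq {V : ProjLine} (h1 : toPGL M = toPGL N) {i : Fin 2}
    (hM : IsRep (rowVec g h M i) V.1) : IsRep (rowVec g h N i) V.1 := by
  rcases toPGL_eq_iff.1 h1 with rfl | rfl
  · exact hM
  · rw [rowVec_neg]; exact hM.neg

end RowVec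

lemma prodE_congr {a b : ℕ → ℤ} {m : ℕ} (h : ∀ j < m, a j = b j) : prodE a m = prodE b m := by
  induction m with
  | zero => rfl
  | succ m ih =>
    rw [prodE, prodE, ih fun j hj => h j (by omega), h m (by omega)]

section Code

variable {g h : Fin 2 → ℤ} {P Q : ProjLine}

lemma IsCode.isRep_zero (hgh : IsUnit (det2 g h)) {w : distantGraph.Walk P Q} {a : ℕ → ℤ}
    (ha : IsCode g h w a) {i : ℕ} (hi : i ≤ w.length) :
    IsRep (rowVec g h (prodE a i) 0) (w.getVert i).1 :=
  ⟨isCoprime_of_isUnit_det2 (by rwa [det2_rowVec g h (prodE a i)]), ha i hi⟩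

lemma IsCode.isRep_end (hgh : IsUnit (det2 g h)) {w : distantGraph.Walk P Q} {a : ℕ → ℤ}
    (ha : IsCode g h w a) : IsRep (rowVec g h (prodE a w.length) 0) Q.1 := by
  have := ha.isRep_zero hgh le_rfl
  rwa [w.getVert_length] at this

/-- The second row of the product coding a path generates the vertex before the last one. -/
lemma IsCode.isRep_one (hgh : IsUnit (det2 g h)) {w : distantGraph.Walk P Q} {a : ℕ → ℤ}
    (ha : IsCode g h w a) (hw : w.length ≠ 0) :
    IsRep (rowVec g h (prodE a w.length) 1) (w.getVert (w.length - 1)).1 := by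
  obtain ⟨m, hm⟩ := Nat.exists_eq_succ_of_ne_zero hw
  have := ha.isRep_zero hgh (i := m) (by omega)
  rw [hm, Nat.succ_eq_add_one, Nat.add_sub_cancel, prodE, rowVec_E_mul_one]
  exact this.neg

/-- Given a code of the first `m` steps, the next vertex has a generator whose coordinate on the
second row of the product is `1`, and the coordinate on the first row is the next integer. -/
lemma exists_isCode (hgh : IsUnit (det2 g h)) (hg : IsRep g P.1) (w : distantGraph.Walk P Q) :
    ∃ a, IsCode g h w a := by
  suffices H : ∀ m ≤ w.length, ∃ a, ∀ i ≤ m, IsRep (rowVec g h (prodE a i) 0) (w.getVert i).1 by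
    obtain ⟨a, ha⟩ := H _ le_rfl
    exact ⟨a, fun i hi => (ha i hi).2⟩
  intro m
  induction m with
  | zero =>
    refine fun _ => ⟨0, fun i hi => ?_⟩
    obtain rfl : i = 0 := by omega
    rw [w.getVert_zero, prodE, rowVec_one_zero]
    exact hg
  | succ m ih =>
    intro hm
    obtain ⟨a, ha⟩ := ih (by omega)
    have hadj : Distant (w.getVert m) (w.getVert (m + 1)) := w.adj_getVert_succ (by omega)
    obtain ⟨u, hu⟩ := (w.getVert (m + 1)).2
    have hM := det2_rowVec g h (prodE a m)
    obtain ⟨α, β, rfl⟩ := exists_comb (by rwa [hM]) u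
    have hβ : β = 1 ∨ β = -1 := by
      have h1 := hadj _ _ (ha m le_rfl) hu
      rw [show ∀ s : Fin 2 → ℤ, det2 (rowVec g h (prodE a m) 0) s =
        det2 ((1 : ℤ) • rowVec g h (prodE a m) 0 + (0 : ℤ) • rowVec g h (prodE a m) 1) s by simp,
        det2_comb] at h1
      have := isUnit_of_mul_isUnit_left h1
      rw [Int.isUnit_iff] at this
      simpa using this
    obtain ⟨γ, hγ⟩ : ∃ γ : ℤ, IsRep (γ • rowVec g h (prodE a m) 0 + rowVec g h (prodE a m) 1)
        (w.getVert (m + 1)).1 := by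
      rcases hβ with rfl | rfl
      · exact ⟨α, by simpa using hu⟩
      · refine ⟨-α, ?_⟩
        convert hu.neg using 1
        module
    have hc : ∀ i ≤ m, prodE (Function.update a m γ) i = prodE a i := fun i hi =>
      prodE_congr fun j hj => Function.update_of_ne (by omega) _ _
    refine ⟨Function.update a m γ, fun i hi => ?_⟩
    rcases Nat.lt_or_ge m i with h | h
    · obtain rfl : i = m + 1 := by omega
      rw [prodE, hc m le_rfl, Function.update_self, rowVec_E_mul_zero]
      exact hγ
    · rw [hc i h]
      exact ha i h

lemma IsCode.neg_basis {w : distantGraph.Walk P Q} {a : ℕ → ℤ} (ha : IsCode g h w a) :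
    IsCode (-g) (-h) w a := by
  intro i hi
  rw [ha i hi, ← Submodule.span_neg, Set.neg_singleton]
  congr 2
  module

end Code

/-! ### The coding basis -/

section Frame

variable {x y g h : Fin 2 → ℤ} {P Q : ProjLine}

lemma det2_smul_add_smul_right (x f : Fin 2 → ℤ) (p q : ℤ) :
    det2 x (p • x + q • f) = q * det2 x f := by
  simp only [det2_apply, Pi.add_apply, Pi.smul_apply, smul_eq_mul]; ring

/-- The coordinates of `y` in the first basis: the quadrant conditions amount to
`0 ≤ p / q ≤ 1`, and the bounds are strict because `ℤx` and `ℤy` are not adjacent. -/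
lemma IsFirstBasis.lt (hx : IsRep x P.1) (hy : IsRep y Q.1) (hPQ : ¬ distantGraph.Adj P Q)
    (hpos : 0 < det2 x y) {e f : Fin 2 → ℤ} (hef : IsFirstBasis x y e f) {p q : ℤ}
    (hpq : y = p • x + q • f) : 0 < p ∧ p < q := by
  obtain ⟨hxe, rfl, ⟨α, β, hα, -, he⟩, ⟨α', β', hα', -, hf⟩⟩ := hef
  have hxf : det2 x (e - x) = 1 := by
    rw [← hxe]; simp only [det2_apply, Pi.sub_apply]; ring
  have hq : det2 x y = q := by rw [hpq, det2_smul_add_smul_right, hxf, mul_one]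
  have hne1 : q ≠ 1 := by
    rintro rfl
    exact hPQ ((distant_iff hx hy).2 (by rw [hq]; exact isUnit_one))
  rw [hq] at hpos
  -- A common divisor of both coordinates of `y` is a unit.
  have hdiv : ∀ c : ℤ, ∀ v : Fin 2 → ℤ, y = c • v → IsUnit c := by
    rintro c v rfl
    exact hy.1.isUnit_of_dvd' (Dvd.intro _ rfl) (Dvd.intro _ rfl)
  have hqR : (x 0 : ℝ) * y 1 - y 0 * x 1 = q := by
    rw [← hq, det2_apply]; push_cast; ring
  have hy0 : y 0 = p * x 0 + q * (e 0 - x 0) := by rw [hpq]; simp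
  have hy1 : y 1 = p * x 1 + q * (e 1 - x 1) := by rw [hpq]; simp
  rw [det2_apply] at hxe
  have hp : 0 ≤ p := by
    have h1 : ((e - x) 0 : ℝ) * y 1 - y 0 * ((e - x) 1 : ℤ) = -p := by
      have : (e - x) 0 * y 1 - y 0 * (e - x) 1 = -p := by
        rw [hy0, hy1]; simp only [Pi.sub_apply]; linear_combination -p * hxe
      exact_mod_cast this
    rw [hf, hf] at h1
    have h2 : (-p : ℝ) = α' * q := by rw [← h1, ← hqR]; ring
    have h3 : (0 : ℝ) < q := by exact_mod_cast hpos
    have h4 : (0 : ℝ) ≤ p := by nlinarith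
    exact_mod_cast h4
  have hpq' : p ≤ q := by
    have h1 : (e 0 : ℝ) * y 1 - y 0 * e 1 = q - p := by
      have : e 0 * y 1 - y 0 * e 1 = q - p := by
        rw [hy0, hy1]; linear_combination (q - p) * hxe
      exact_mod_cast this
    rw [he, he] at h1
    have h2 : (q - p : ℝ) = α * q := by rw [← h1, ← hqR]; ring
    have h3 : (0 : ℝ) < q := by exact_mod_cast hpos
    have h4 : (p : ℝ) ≤ q := by nlinarith
    exact_mod_cast h4
  have hqu : ¬ IsUnit q := by
    rw [Int.isUnit_iff]; omega
  refine ⟨lt_of_le_of_ne hp ?_, lt_of_le_of_ne hpq' ?_⟩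
  · rintro rfl
    exact hqu (hdiv q (e - x) (by rw [hpq]; module))
  · rintro rfl
    exact hqu (hdiv p e (by rw [hpq]; module))

lemma IsFirstBasis.det2_eq {e f : Fin 2 → ℤ} (hef : IsFirstBasis x y e f) : det2 x f = 1 := by
  obtain ⟨hxe, rfl, -, -⟩ := hef
  rw [← hxe]; simp only [det2_apply, Pi.sub_apply]; ring

lemma IsFrame.exists_coords (hF : IsFrame P Q x y g h) (hPQ : ¬ distantGraph.Adj P Q) :
    IsUnit (det2 g h) ∧ IsRep g P.1 ∧ ∃ p q : ℤ, y = p • g + q • h ∧ 0 < p ∧ 2 * p ≤ q := by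
  obtain ⟨hx, hy, hpos, e, f, hef, p, q, hpq, H⟩ := hF
  obtain ⟨hp, hq⟩ := hef.lt hx hy hPQ hpos hpq
  have hpQ : (0 : ℚ) < p := by exact_mod_cast hp
  rcases H with ⟨h2, rfl, rfl⟩ | ⟨h2, rfl, rfl⟩
  · refine ⟨by rw [hef.det2_eq]; exact isUnit_one, hx, p, q, hpq, hp, ?_⟩
    rw [le_div_iff₀ hpQ] at h2
    exact_mod_cast h2
  · have hd : det2 (-x) h = -1 := by
      rw [← hef.1]; simp only [det2_apply, Pi.neg_apply]; ring
    refine ⟨by rw [hd]; exact isUnit_one.neg, hx.neg, q - p, q, ?_, by omega, ?_⟩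
    · rw [hpq, hef.2.1]; module
    · rw [div_lt_iff₀ hpQ] at h2
      have : q < 2 * p := by exact_mod_cast h2
      omega

lemma IsFrame.neg (hF : IsFrame P Q x y g h) : IsFrame P Q (-x) (-y) (-g) (-h) := by
  obtain ⟨hx, hy, hpos, e, f, ⟨hxe, hfe, ⟨α, β, hα, hβ, he⟩, ⟨α', β', hα', hβ', hf⟩⟩, p, q, hpq,
    H⟩ := hF
  have hd (u v : Fin 2 → ℤ) : det2 (-u) (-v) = det2 u v := by
    simp only [det2_apply, Pi.neg_apply]; ring
  refine ⟨hx.neg, hy.neg, by rwa [hd], -e, -f, ⟨by rw [hd, hxe], by rw [hfe]; abel,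
    ⟨α, β, hα, hβ, fun i => ?_⟩, ⟨α', β', hα', hβ', fun i => ?_⟩⟩, p, q, by rw [hpq]; module, ?_⟩
  · have := he i
    simp only [Pi.neg_apply, Int.cast_neg]; linear_combination -this
  · have := hf i
    simp only [Pi.neg_apply, Int.cast_neg]; linear_combination -this
  · rcases H with ⟨h2, rfl, rfl⟩ | ⟨h2, rfl, rfl⟩
    · exact Or.inl ⟨h2, rfl, rfl⟩
    · exact Or.inr ⟨h2, rfl, rfl⟩

lemma IsFrame.eq {g' h' : Fin 2 → ℤ} (hF : IsFrame P Q x y g h) (hF' : IsFrame P Q x y g' h')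
    (hPQ : ¬ distantGraph.Adj P Q) : g' = g ∧ h' = h := by
  obtain ⟨hx, hy, hpos, e, f, hef, p, q, hpq, H⟩ := hF
  obtain ⟨-, -, -, e', f', hef', p', q', hpq', H'⟩ := hF'
  obtain ⟨hp, hq⟩ := hef.lt hx hy hPQ hpos hpq
  obtain ⟨hp', hq'⟩ := hef'.lt hx hy hPQ hpos hpq'
  obtain ⟨α, β, hf'⟩ := exists_comb (by rw [hef.det2_eq]; exact isUnit_one) f'
  have hβ : β = 1 := by
    have := hef'.det2_eq
    rwa [hf', det2_smul_add_smul_right, hef.det2_eq, mul_one] at this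
  subst hβ
  have h1 : p • x + q • f = (p' + q' * α) • x + q' • f := by
    rw [← hpq, hpq', hf']; module
  obtain ⟨h2, rfl⟩ := comb_inj (by rw [hef.det2_eq]; exact one_ne_zero) h1
  -- Both `p` and `p'` lie strictly between `0` and `q`.
  have hα : α = 0 := by
    rcases lt_trichotomy α 0 with h | h | h
    · nlinarith
    · exact h
    · nlinarith
  subst hα
  obtain rfl : p = p' := by simpa using h2
  obtain rfl : f' = f := by simpa using hf'
  obtain rfl : e' = e := by
    have h3 := hef.2.1
    rw [hef'.2.1] at h3
    simpa using h3
  rcases H with ⟨h2, rfl, rfl⟩ | ⟨h2, rfl, rfl⟩ <;> rcases H' with ⟨h3, rfl, rfl⟩ | ⟨h3, rfl, rfl⟩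
  · exact ⟨rfl, rfl⟩
  · exact absurd h3 h2.not_gt
  · exact absurd h2 h3.not_gt
  · exact ⟨rfl, rfl⟩

/-- The coding basis is determined by the two points up to a common sign. -/
lemma IsFrame.eq_or_eq_neg {x' y' g' h' : Fin 2 → ℤ} (hF : IsFrame P Q x y g h)
    (hF' : IsFrame P Q x' y' g' h') (hPQ : ¬ distantGraph.Adj P Q) :
    (y' = y ∧ g' = g ∧ h' = h) ∨ (y' = -y ∧ g' = -g ∧ h' = -h) := by
  have hpos := hF.2.2.1
  have hpos' := hF'.2.2.1
  rcases hF.1.eq_or_eq_neg hF'.1 with rfl | rfl <;>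
    rcases hF.2.1.eq_or_eq_neg hF'.2.1 with rfl | rfl
  · exact Or.inl ⟨rfl, hF.eq hF' hPQ⟩
  · simp only [det2_apply, Pi.neg_apply] at hpos hpos'
    linarith
  · simp only [det2_apply, Pi.neg_apply] at hpos hpos'
    linarith
  · exact Or.inr ⟨rfl, hF.neg.eq hF' hPQ⟩

/-- Of the vectors `f` with `det [x, f] = 1`, the one in the second quadrant is found by division
with remainder. -/
lemma exists_isFrame (hne : P ≠ Q) : ∃ x y g h, IsFrame P Q x y g h := by
  obtain ⟨x, hx⟩ := P.2
  obtain ⟨y, hy, hpos⟩ : ∃ y, IsRep y Q.1 ∧ 0 < det2 x y := by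
    obtain ⟨y, hy⟩ := Q.2
    rcases lt_trichotomy (det2 x y) 0 with h | h | h
    · refine ⟨-y, hy.neg, ?_⟩
      simp only [det2_apply, Pi.neg_apply] at h ⊢
      linarith
    · exfalso
      apply hne
      rcases eq_or_eq_neg_of_det2_eq_zero hx.1 hy.1 h with rfl | rfl
      · exact ProjLine.eq_of_isRep hx hy
      · exact ProjLine.eq_of_isRep hx.neg hy
    · exact ⟨y, hy, h⟩
  obtain ⟨a, b, hab⟩ := hx.1
  have hc : det2 x ![-b, a] = 1 := by
    rw [det2_apply]; simp; linarith
  obtain ⟨α, q, hyc⟩ := exists_comb (by rw [hc]; exact isUnit_one) y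
  have hq : 0 < q := by rwa [hyc, det2_smul_add_smul_right, hc, mul_one] at hpos
  -- The vector `f` is chosen so that the first coordinate of `y` is the residue of `α` modulo `q`.
  obtain ⟨f, hf⟩ : ∃ f, f = ![-b, a] + (α / q) • x := ⟨_, rfl⟩
  have hxf : det2 x f = 1 := by
    rw [← hc, hf]; simp only [det2_apply, Pi.add_apply, Pi.smul_apply, smul_eq_mul]; ring
  have hy' : y = (α % q) • x + q • f := by
    rw [hyc, hf, Int.emod_def]; module
  have h0 := Int.emod_nonneg α hq.ne'
  have h1 := Int.emod_lt_of_pos α hq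
  generalize α % q = p at *
  have hqR : (0 : ℝ) < q := by exact_mod_cast hq
  have h0R : (0 : ℝ) ≤ p := by exact_mod_cast h0
  have h1R : (p : ℝ) < q := by exact_mod_cast h1
  have hyi (i : Fin 2) : (y i : ℝ) = p * x i + q * f i := by
    rw [hy']; simp
  have hfb : IsFirstBasis x y (f + x) f := by
    refine ⟨?_, by simp, ⟨(q - p) / q, 1 / q, ?_, ?_, fun i => ?_⟩,
      ⟨-p / q, 1 / q, ?_, ?_, fun i => ?_⟩⟩
    · rw [← hxf]; simp only [det2_apply, Pi.add_apply]; ring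
    · exact div_nonneg (by linarith) hqR.le
    · positivity
    · rw [hyi]; push_cast [Pi.add_apply]; field_simp; ring
    · exact div_nonpos_of_nonpos_of_nonneg (by linarith) hqR.le
    · positivity
    · rw [hyi]; field_simp; ring
  rcases le_or_gt 2 ((q : ℚ) / p) with h2 | h2
  · exact ⟨x, y, x, f, hx, hy, hpos, _, _, hfb, p, q, hy', Or.inl ⟨h2, rfl, rfl⟩⟩
  · exact ⟨x, y, -x, f + x, hx, hy, hpos, _, _, hfb, p, q, hy', Or.inr ⟨h2, rfl, rfl⟩⟩

/-- A path is represented by the class of `N`, whose first row generates the end of the path, if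
and only if the second row of `N` generates the vertex before the last one. -/
lemma represents_toPGL_iff (hF : IsFrame P Q x y g h) (hPQ : ¬ distantGraph.Adj P Q)
    {w : distantGraph.Walk P Q} (hw : w.length ≠ 0)
    {N : Matrix.SpecialLinearGroup (Fin 2) ℤ} (hN : IsRep (rowVec g h N 0) Q.1) :
    Represents w (toPGL N) ↔ IsRep (rowVec g h N 1) (w.getVert (w.length - 1)).1 := by
  obtain ⟨hgh, hg, -⟩ := hF.exists_coords hPQ
  constructor
  · intro H
    obtain ⟨a, ha, haN⟩ := H x y g h hF
    exact (ha.isRep_one hgh hw).rowVec_of_toPGL_eq haN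
  · intro H x' y' g' h' hF'
    obtain ⟨a, ha⟩ := exists_isCode hgh hg w
    have haN := toPGL_eq_of_isRep hgh (ha.isRep_end hgh) hN (ha.isRep_one hgh hw) H
    rcases hF.eq_or_eq_neg hF' hPQ with ⟨-, rfl, rfl⟩ | ⟨-, rfl, rfl⟩
    · exact ⟨a, ha, haN⟩
    · exact ⟨a, ha.neg_basis, haN⟩

lemma Represents.eq {M M' : Matrix.ProjGenLinGroup (Fin 2) ℤ} (hF : IsFrame P Q x y g h)
    (hPQ : ¬ distantGraph.Adj P Q) {w : distantGraph.Walk P Q} (hw : w.length ≠ 0)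
    (hM : Represents w M) (hM' : Represents w M') : M = M' := by
  obtain ⟨hgh, -⟩ := hF.exists_coords hPQ
  obtain ⟨a, ha, rfl⟩ := hM x y g h hF
  obtain ⟨b, hb, rfl⟩ := hM' x y g h hF
  exact toPGL_eq_of_isRep hgh (ha.isRep_end hgh) (hb.isRep_end hgh) (ha.isRep_one hgh hw)
    (hb.isRep_one hgh hw)

end Frame

/-! ### Continued fractions and convergents -/

/-- The convergents of `[d_0; d_1, …]` as vectors: if `c_i` has coordinates `(p, q)` with respect to
`(g, h)`, then `q / p` is the convergent. The index is shifted by two, so that `c_0 = g` and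
`c_1 = h` and `c_{n+2}` is the value of `[d_0; …, d_n]`. -/
def conv (g h : Fin 2 → ℤ) (d : ℕ → ℕ) : ℕ → Fin 2 → ℤ
  | 0 => g
  | 1 => h
  | i + 2 => (d i : ℤ) • conv g h d (i + 1) + conv g h d i

lemma conv_add_two (g h : Fin 2 → ℤ) (d : ℕ → ℕ) (i : ℕ) :
    conv g h d (i + 2) = (d i : ℤ) • conv g h d (i + 1) + conv g h d i := rfl

lemma conv_succ_eq_shift (g h : Fin 2 → ℤ) (d : ℕ → ℕ) (i : ℕ) :
    conv g h d (i + 1) = conv h ((d 0 : ℤ) • h + g) (fun j => d (j + 1)) i := by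
  induction i using Nat.twoStepInduction with
  | zero => rfl
  | one => rfl
  | more i h1 h2 => rw [conv_add_two g h d (i + 1), h1, h2, conv_add_two]

lemma conv_add_two_eq (g h : Fin 2 → ℤ) {n : ℕ} {d : ℕ → ℕ} (hd : ∀ i ≤ n, 0 < d i) :
    ∃ p q : ℤ, 0 < p ∧ 0 < q ∧ conv g h d (n + 2) = p • g + q • h ∧ cfVal n d = (q : ℚ) / p := by
  induction n generalizing g h d with
  | zero =>
    refine ⟨1, d 0, one_pos, by exact_mod_cast hd 0 le_rfl, ?_, by simp [cfVal]⟩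
    simp only [conv]; module
  | succ n ih =>
    obtain ⟨p, q, hp, hq, h1, h2⟩ :=
      ih h ((d 0 : ℤ) • h + g) (d := fun j => d (j + 1)) fun i hi => hd _ (by omega)
    refine ⟨q, p + q * d 0, hq, by positivity, ?_, ?_⟩
    · rw [conv_succ_eq_shift, h1]; module
    · have hpQ : (p : ℚ) ≠ 0 := by exact_mod_cast hp.ne'
      have hqQ : (q : ℚ) ≠ 0 := by exact_mod_cast hq.ne'
      rw [cfVal, h2]; push_cast; field_simp; ring

lemma one_lt_cfVal {n : ℕ} {d : ℕ → ℕ} (hd : ∀ i ≤ n, 0 < d i) (hn : 1 < d n) :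
    1 < cfVal n d := by
  induction n generalizing d with
  | zero => rw [cfVal]; exact_mod_cast hn
  | succ n ih =>
    have h1 := ih (d := fun j => d (j + 1)) (fun i hi => hd _ (by omega)) hn
    have h2 : (1 : ℚ) ≤ d 0 := by exact_mod_cast hd 0 (by omega)
    have h3 : 0 < 1 / cfVal n (fun j => d (j + 1)) := by positivity
    rw [cfVal]; linarith

lemma two_le_of_two_le_cfVal {n : ℕ} {d : ℕ → ℕ} (hd : ∀ i, 1 ≤ i → i ≤ n → 0 < d i)
    (hn : 1 < d n) (h : 2 ≤ cfVal n d) : 2 ≤ d 0 := by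
  cases n with
  | zero => exact hn
  | succ n =>
    have h1 := one_lt_cfVal (d := fun j => d (j + 1)) (n := n)
      (fun i hi => hd _ (by omega) (by omega)) hn
    have h2 : 1 / cfVal n (fun j => d (j + 1)) < 1 := by
      rw [div_lt_one (by linarith)]; exact h1
    rw [cfVal] at h
    have h3 : (1 : ℚ) < d 0 := by linarith
    exact_mod_cast h3

lemma exists_cfVal_eq {p q : ℕ} (hp : 0 < p) (hpq : p < q) :
    ∃ n d, (∀ i, 0 < d i) ∧ 1 < d n ∧ cfVal n d = (q : ℚ) / p := by
  induction p using Nat.strong_induction_on generalizing q with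
  | _ p ih =>
    have hpQ : (p : ℚ) ≠ 0 := by exact_mod_cast hp.ne'
    have hdm := Nat.div_add_mod q p
    have hdiv : 0 < q / p := Nat.div_pos hpq.le hp
    rcases Nat.eq_zero_or_pos (q % p) with h0 | h0
    · refine ⟨0, fun _ => q / p, fun _ => hdiv, ?_, ?_⟩
      · change 1 < q / p
        by_contra h
        have : q / p = 1 := by omega
        rw [this, h0] at hdm; omega
      · rw [cfVal, eq_div_iff hpQ]
        rw [h0] at hdm
        exact_mod_cast (by linarith : q / p * p = q)
    · obtain ⟨n, d, hd, hn, hval⟩ := ih (q % p) (Nat.mod_lt _ hp) h0 (Nat.mod_lt _ hp)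
      refine ⟨n + 1, fun i => Nat.casesOn i (q / p) d, fun i => ?_, hn, ?_⟩
      · cases i with
        | zero => exact hdiv
        | succ i => exact hd i
      · have h1 : (p : ℚ) * ((q / p : ℕ) : ℚ) + ((q % p : ℕ) : ℚ) = q := by exact_mod_cast hdm
        change ((q / p : ℕ) : ℚ) + 1 / cfVal n d = (q : ℚ) / p
        have hrQ : ((q % p : ℕ) : ℚ) ≠ 0 := by exact_mod_cast h0.ne'
        rw [hval, eq_div_iff hpQ]
        generalize ((q / p : ℕ) : ℚ) = s at *
        generalize ((q % p : ℕ) : ℚ) = t at *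
        field_simp
        linarith

lemma IsRep.smul {v : Fin 2 → ℤ} {V : Submodule ℤ (Fin 2 → ℤ)} (hv : IsRep v V) {s : ℤ}
    (hs : IsUnit s) : IsRep (s • v) V := by
  rcases Int.isUnit_iff.1 hs with rfl | rfl
  · simpa using hv
  · simpa using hv.neg

/-- Up to signs, the rows of the standard product are two consecutive convergents. -/
lemma rowVec_prodE_standardCode (g h : Fin 2 → ℤ) (d : ℕ → ℕ) (i : ℕ) :
    ∃ s : ℤ, IsUnit s ∧ rowVec g h (prodE (standardCode d) (i + 1)) 0 = s • conv g h d (i + 1) ∧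
      rowVec g h (prodE (standardCode d) (i + 1)) 1 = (-((-1) ^ i * s)) • conv g h d i := by
  induction i with
  | zero =>
    refine ⟨1, isUnit_one, ?_, ?_⟩
    · rw [prodE, rowVec_E_mul_zero, prodE, rowVec_one_one]; simp [standardCode, conv]
    · rw [prodE, rowVec_E_mul_one, prodE, rowVec_one_zero]; simp [conv]
  | succ i ih =>
    obtain ⟨s, hs, h0, h1⟩ := ih
    refine ⟨(-1) ^ (i + 1) * s, (isUnit_one.neg.pow _).mul hs, ?_, ?_⟩
    · rw [prodE, rowVec_E_mul_zero, h0, h1, conv_add_two, standardCode]; module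
    · have h2 : ((-1 : ℤ) ^ (i + 1)) * ((-1) ^ (i + 1) * s) = s := by
        rw [← mul_assoc, ← mul_pow]; simp
      rw [prodE, rowVec_E_mul_one, h0, h2]; module

/-! ### Distances to convergents -/

section Distance

variable {g h : Fin 2 → ℤ} {P : ProjLine} {d : ℕ → ℕ}

lemma isUnit_det2_conv (hgh : IsUnit (det2 g h)) (d : ℕ → ℕ) (i : ℕ) :
    IsUnit (det2 (conv g h d (i + 1)) (conv g h d i)) := by
  induction i with
  | zero =>
    have : det2 h g = -det2 g h := by simp only [det2_apply]; ring
    change IsUnit (det2 h g)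
    rw [this]; exact hgh.neg
  | succ i ih =>
    have : det2 (conv g h d (i + 2)) (conv g h d (i + 1)) =
        -det2 (conv g h d (i + 1)) (conv g h d i) := by
      simp only [conv_add_two, det2_apply, Pi.add_apply, Pi.smul_apply, smul_eq_mul]; ring
    rw [this]; exact ih.neg

lemma det2_conv (g h : Fin 2 → ℤ) {i : ℕ} (hd : ∀ j < i, 0 < d j) :
    ∃ k k' : ℤ, 0 ≤ k ∧ 0 < k' ∧ det2 g (conv g h d i) = k * det2 g h ∧
      det2 g (conv g h d (i + 1)) = k' * det2 g h := by
  induction i with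
  | zero => exact ⟨0, 1, le_rfl, one_pos, by simp [conv, det2_apply], by simp [conv]⟩
  | succ i ih =>
    obtain ⟨k, k', hk, hk', h1, h2⟩ := ih fun j hj => hd j (by omega)
    have h0 : (0 : ℤ) < d i := by exact_mod_cast hd i (by omega)
    refine ⟨k', d i * k' + k, hk'.le, by positivity, h2, ?_⟩
    rw [add_mul, mul_assoc, ← h1, ← h2, conv_add_two]
    simp only [det2_apply, Pi.add_apply, Pi.smul_apply, smul_eq_mul]; ring

/-- The starting point `ℤg` is not in the cone of `c_{i+1}` and `c_i + j c_{i+1}`: the linear form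
`det [g, ·] / det [g, h]` vanishes at `g` and is positive on this cone. -/
lemma not_isRep_cone (hgh : IsUnit (det2 g h)) (hg : IsRep g P.1) {i : ℕ}
    (hd : ∀ j < i, 0 < d j) (j : ℕ) (α β : ℤ) (hα : 0 < α) (hβ : 0 < β) :
    ¬ IsRep (α • conv g h d (i + 1) + β • ((j : ℤ) • conv g h d (i + 1) + conv g h d i)) P.1 := by
  intro H
  obtain ⟨k, k', hk, hk', h1, h2⟩ := det2_conv g h hd
  have h3 : det2 g (α • conv g h d (i + 1) + β • ((j : ℤ) • conv g h d (i + 1) + conv g h d i)) =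
      (α * k' + β * (j * k' + k)) * det2 g h := by
    have : (α * k' + β * (j * k' + k)) * det2 g h =
      (α + β * j) * (k' * det2 g h) + β * (k * det2 g h) := by ring
    rw [this, ← h1, ← h2]
    simp only [det2_apply, Pi.add_apply, Pi.smul_apply, smul_eq_mul]; ring
  have h4 : (α * k' + β * (j * k' + k)) * det2 g h = 0 := by
    rw [← h3]
    rcases hg.eq_or_eq_neg H with h | h <;> rw [h] <;>
      simp only [det2_apply, Pi.neg_apply] <;> ring
  have h5 : 0 < α * k' + β * (j * k' + k) := by positivity
  exact (mul_ne_zero h5.ne' hgh.ne_zero) h4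

variable {W : ℕ → ℕ → ProjLine}

/-- `W` is the family of intermediate convergents: `W i j` is generated by `c_i + j c_{i+1}`. Thus
`W i 0` is the point of `c_i`, and `W i (d i) = W (i + 2) 0` is that of `c_{i+2}`. -/
def IsIntermediate (g h : Fin 2 → ℤ) (d : ℕ → ℕ) (W : ℕ → ℕ → ProjLine) : Prop :=
  ∀ i j : ℕ, IsRep ((j : ℤ) • conv g h d (i + 1) + conv g h d i) (W i j).1

lemma exists_isIntermediate (hgh : IsUnit (det2 g h)) (d : ℕ → ℕ) :
    ∃ W, IsIntermediate g h d W := by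
  have H : ∀ i j : ℕ, ∃ V : ProjLine,
      IsRep ((j : ℤ) • conv g h d (i + 1) + conv g h d i) V.1 := fun i j => by
    refine exists_isRep_of_isUnit_det2 (v := conv g h d (i + 1)) ?_
    convert (isUnit_det2_conv hgh d i).neg using 1
    simp only [det2_apply, Pi.add_apply, Pi.smul_apply, smul_eq_mul]; ring
  choose W hW using H
  exact ⟨W, hW⟩

lemma IsIntermediate.isRep_conv (hW : IsIntermediate g h d W) (i : ℕ) :
    IsRep (conv g h d i) (W i 0).1 := by
  simpa using hW i 0

lemma IsIntermediate.eq_add_two (hW : IsIntermediate g h d W) (i : ℕ) :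
    W i (d i) = W (i + 2) 0 :=
  ProjLine.eq_of_isRep (hW i (d i)) (hW.isRep_conv (i + 2))

lemma IsIntermediate.zero_eq (hW : IsIntermediate g h d W) (hg : IsRep g P.1) : W 0 0 = P :=
  ProjLine.eq_of_isRep (hW.isRep_conv 0) hg

lemma IsIntermediate.adj (hW : IsIntermediate g h d W) (hgh : IsUnit (det2 g h)) (i : ℕ) :
    distantGraph.Adj (W (i + 1) 0) (W i 0) :=
  (distant_iff (hW.isRep_conv (i + 1)) (hW.isRep_conv i)).2 (isUnit_det2_conv hgh d i)

lemma IsIntermediate.reachable (hW : IsIntermediate g h d W) (hgh : IsUnit (det2 g h))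
    (hg : IsRep g P.1) (i : ℕ) : distantGraph.Reachable P (W i 0) := by
  induction i with
  | zero => rw [hW.zero_eq hg]
  | succ i ih => exact ih.trans (hW.adj hgh i).symm.reachable

lemma isUnit_det2_conv_intermediate (hgh : IsUnit (det2 g h)) (d : ℕ → ℕ) (i j : ℕ) :
    IsUnit (det2 (conv g h d (i + 1)) ((j : ℤ) • conv g h d (i + 1) + conv g h d i)) := by
  convert isUnit_det2_conv hgh d i using 1
  simp only [det2_apply, Pi.add_apply, Pi.smul_apply, smul_eq_mul]; ring

lemma IsIntermediate.isRep_mediant (hW : IsIntermediate g h d W) (i j : ℕ) :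
    IsRep (conv g h d (i + 1) + ((j : ℤ) • conv g h d (i + 1) + conv g h d i)) (W i (j + 1)).1 := by
  convert hW i (j + 1) using 1
  push_cast; module

lemma IsIntermediate.dist_succ (hW : IsIntermediate g h d W) (hgh : IsUnit (det2 g h))
    (hg : IsRep g P.1) {i : ℕ} (hd : ∀ j < i, 0 < d j) (j : ℕ) :
    distantGraph.dist P (W i (j + 1)) =
      1 + min (distantGraph.dist P (W (i + 1) 0)) (distantGraph.dist P (W i j)) :=
  dist_add_eq (isUnit_det2_conv_intermediate hgh d i j) (hW.isRep_conv (i + 1)) (hW i j)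
    (hW.isRep_mediant i j) (not_isRep_cone hgh hg hd j) (hW.reachable hgh hg (i + 1))

lemma IsIntermediate.dist_eq_aux (hW : IsIntermediate g h d W) (hgh : IsUnit (det2 g h))
    (hg : IsRep g P.1) {i : ℕ} (hd : ∀ j < i, 0 < d j)
    (h1 : distantGraph.dist P (W i 0) ≤ distantGraph.dist P (W (i + 1) 0))
    (h2 : distantGraph.dist P (W (i + 1) 0) ≤ distantGraph.dist P (W i 0) + 1) (j : ℕ) :
    distantGraph.dist P (W i (j + 1)) =
      if j = 0 then 1 + distantGraph.dist P (W i 0) else 1 + distantGraph.dist P (W (i + 1) 0) := by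
  induction j with
  | zero => rw [hW.dist_succ hgh hg hd, if_pos rfl, min_eq_right h1]
  | succ j ih =>
    rw [hW.dist_succ hgh hg hd, ih, if_neg (Nat.succ_ne_zero j)]
    by_cases hj : j = 0
    · rw [if_pos hj]; omega
    · rw [if_neg hj]; omega

lemma IsIntermediate.dist_le_and_le (hW : IsIntermediate g h d W) (hgh : IsUnit (det2 g h))
    (hg : IsRep g P.1) {i : ℕ} (hd : ∀ j < i, 0 < d j) :
    distantGraph.dist P (W i 0) ≤ distantGraph.dist P (W (i + 1) 0) ∧
      distantGraph.dist P (W (i + 1) 0) ≤ distantGraph.dist P (W i 0) + 1 := by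
  induction i with
  | zero =>
    have h1 := hW.adj hgh 0
    rw [hW.zero_eq hg] at h1 ⊢
    rw [SimpleGraph.dist_eq_one_iff_adj.2 h1.symm, SimpleGraph.dist_self]
    omega
  | succ i ih =>
    have hd' : ∀ j < i, 0 < d j := fun j hj => hd j (by omega)
    obtain ⟨h1, h2⟩ := ih hd'
    obtain ⟨j, hj⟩ := Nat.exists_eq_succ_of_ne_zero (hd i (by omega)).ne'
    have h3 := hW.dist_eq_aux hgh hg hd' h1 h2 j
    rw [← Nat.succ_eq_add_one, ← hj, hW.eq_add_two] at h3
    rw [show i + 1 + 1 = i + 2 from rfl]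
    split_ifs at h3 <;> omega

/-- The distance to the first intermediate convergent after `c_i` exceeds that to `c_i` by one, and
the distance to all later ones exceeds that to `c_{i+1}` by one. -/
lemma IsIntermediate.dist_eq (hW : IsIntermediate g h d W) (hgh : IsUnit (det2 g h))
    (hg : IsRep g P.1) {i : ℕ} (hd : ∀ j < i, 0 < d j) {j : ℕ} (hj : 0 < j) :
    distantGraph.dist P (W i j) =
      if j = 1 then 1 + distantGraph.dist P (W i 0) else 1 + distantGraph.dist P (W (i + 1) 0) := by
  obtain ⟨h1, h2⟩ := hW.dist_le_and_le hgh hg hd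
  obtain ⟨j, rfl⟩ := Nat.exists_eq_succ_of_ne_zero hj.ne'
  rw [Nat.succ_eq_add_one, hW.dist_eq_aux hgh hg hd h1 h2 j]
  simp

/-- For a sequence with the recursion of the distances to the convergents, stagnation means an odd
number of trailing partial quotients equal to one. -/
lemma succ_eq_iff_odd_trailing_ones {D : ℕ → ℕ} (h0 : D 1 = D 0 + 1) (hd0 : 2 ≤ d 0) {n : ℕ}
    (hd : ∀ i < n, 0 < d i)
    (hD : ∀ i < n, D (i + 2) = if d i = 1 then 1 + D i else 1 + D (i + 1)) :
    D (n + 1) = D n ↔ ∃ k, Odd k ∧ k + 1 ≤ n ∧ (∀ j, 1 ≤ j → j ≤ k → d (n - j) = 1) ∧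
      1 < d (n - k - 1) := by
  induction n using Nat.twoStepInduction with
  | zero => exact ⟨fun h => by rw [zero_add] at h; omega, fun ⟨k, _, h, _⟩ => by omega⟩
  | one =>
    have h1 : D 2 = _ := hD 0 one_pos
    rw [if_neg (by omega), zero_add] at h1
    exact ⟨fun h => by rw [one_add_one_eq_two] at h; omega, fun ⟨k, ⟨m, hm⟩, h, _⟩ => by omega⟩
  | more n ih _ =>
    have ih' := ih (fun i hi => hd i (by omega)) (fun i hi => hD i (by omega))
    have h1 := hD (n + 1) (by omega)
    have h2 := hD n (by omega)
    rw [show n + 1 + 2 = n + 2 + 1 by ring, show n + 1 + 1 = n + 2 by ring] at h1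
    have hdn := hd n (by omega)
    by_cases ha : d (n + 1) = 1
    · by_cases hb : d n = 1
      · rw [if_pos ha] at h1
        rw [if_pos hb] at h2
        have : D (n + 2 + 1) = D (n + 2) ↔ D (n + 1) = D n := by omega
        rw [this, ih']
        constructor
        · rintro ⟨k, ⟨m, hm⟩, hk, hj, hlast⟩
          refine ⟨k + 2, ⟨m + 1, by omega⟩, by omega, fun j hj1 hj2 => ?_, ?_⟩
          · rcases (by omega : j = 1 ∨ j = 2 ∨ 3 ≤ j) with rfl | rfl | h3
            · exact ha
            · exact hb
            · have := hj (j - 2) (by omega) (by omega)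
              rwa [show n - (j - 2) = n + 2 - j by omega] at this
          · rwa [show n + 2 - (k + 2) - 1 = n - k - 1 by omega]
        · rintro ⟨k, ⟨m, hm⟩, hk, hj, hlast⟩
          have hk1 : k ≠ 1 := by
            rintro rfl
            rw [show n + 2 - 1 - 1 = n by omega] at hlast
            omega
          refine ⟨k - 2, ⟨m - 1, by omega⟩, by omega, fun j hj1 hj2 => ?_, ?_⟩
          · have := hj (j + 2) (by omega) (by omega)
            rwa [show n + 2 - (j + 2) = n - j by omega] at this
          · rwa [show n - (k - 2) - 1 = n + 2 - k - 1 by omega]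
      · rw [if_pos ha] at h1
        rw [if_neg hb] at h2
        refine iff_of_true (by omega) ⟨1, odd_one, by omega, fun j hj1 hj2 => ?_, ?_⟩
        · rwa [show n + 2 - j = n + 1 by omega]
        · rw [show n + 2 - 1 - 1 = n by omega]; omega
    · rw [if_neg ha] at h1
      refine iff_of_false (by omega) ?_
      rintro ⟨k, ⟨m, hm⟩, -, hj, -⟩
      exact ha (hj 1 le_rfl (by omega))

end Distance

/-! ### Shortest paths to the end of a continued fraction -/

lemma exists_isSlopeExpansion {P Q : ProjLine} (hne : P ≠ Q) (hPQ : ¬ distantGraph.Adj P Q) :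
    ∃ n d, IsSlopeExpansion P Q n d := by
  obtain ⟨x, y, g, h, hF⟩ := exists_isFrame hne
  obtain ⟨-, -, p, q, hy, hp, hpq⟩ := hF.exists_coords hPQ
  lift p to ℕ using hp.le
  lift q to ℕ using by omega
  obtain ⟨n, d, hd, hn, hval⟩ := exists_cfVal_eq (p := p) (q := q) (by omega) (by omega)
  exact ⟨n, d, fun i _ _ => hd i, hn, x, y, g, h, hF, p, q, hy, by simpa using hval⟩

/-- In a coding basis, the end of the paths is generated by the last convergent `c_{n+2}`, and the
first partial quotient is at least two because the slope is. -/
lemma IsSlopeExpansion.two_le_and_isRep {P Q : ProjLine} (hPQ : ¬ distantGraph.Adj P Q) {n : ℕ}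
    {d : ℕ → ℕ} (hnd : IsSlopeExpansion P Q n d) :
    ∃ x y g h, IsFrame P Q x y g h ∧ 2 ≤ d 0 ∧ IsRep (conv g h d (n + 2)) Q.1 := by
  obtain ⟨hd, hn, x, y, g, h, hF, p, q, hy, hval⟩ := hnd
  obtain ⟨hgh, -, p', q', hy', hp, hpq⟩ := hF.exists_coords hPQ
  obtain ⟨rfl, rfl⟩ := comb_inj hgh.ne_zero (hy.symm.trans hy')
  have hpQ : (0 : ℚ) < p := by exact_mod_cast hp
  have h0 : 2 ≤ d 0 := by
    refine two_le_of_two_le_cfVal hd hn ?_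
    rw [hval, le_div_iff₀ hpQ]
    exact_mod_cast hpq
  refine ⟨x, y, g, h, hF, h0, ?_⟩
  have hd' : ∀ i ≤ n, 0 < d i := fun i hi => by
    rcases Nat.eq_zero_or_pos i with rfl | hi'
    · omega
    · exact hd i hi' hi
  obtain ⟨p', q', hp', -, hc, hval'⟩ := conv_add_two_eq g h hd'
  have hpQ' : (0 : ℚ) < p' := by exact_mod_cast hp'
  rw [hval, div_eq_div_iff hpQ.ne' hpQ'.ne'] at hval'
  have hval'' : q * p' = q' * p := by exact_mod_cast hval'
  have hcop : IsCoprime (conv g h d (n + 2) 0) (conv g h d (n + 2) 1) :=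
    isCoprime_of_isUnit_det2 (isUnit_det2_conv hgh d (n + 1))
  have hdet : det2 y (conv g h d (n + 2)) = 0 := by
    rw [hc, hy, det2_comb, show p * q' - q * p' = 0 by linarith, zero_mul]
  rcases eq_or_eq_neg_of_det2_eq_zero hF.2.1.1 hcop hdet with h1 | h1 <;> rw [h1]
  · exact hF.2.1
  · exact hF.2.1.neg

theorem proposition3 (P Q : ProjLine) (hne : P ≠ Q) (hPQ : ¬ distantGraph.Adj P Q) :
    (∃ n d, IsSlopeExpansion P Q n d) ∧
    ∀ (n : ℕ) (d : ℕ → ℕ), IsSlopeExpansion P Q n d →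
      -- every shortest path is represented by a matrix, and at most two matrices occur
      (∀ w : distantGraph.Walk P Q, IsShortest w → ∃ M, Represents w M) ∧
      (representingMatrices P Q).encard ≤ 2 ∧
      -- the standard matrix is always one of them
      toPGL (standardMatrix n d) ∈ representingMatrices P Q ∧
      -- all the shortest paths are represented by precisely one matrix iff ...
      ((∃! M, ∀ w : distantGraph.Walk P Q, IsShortest w → Represents w M) ↔
        (2 < d n ∨
          ∃ k, Odd k ∧ k + 1 ≤ n ∧ d n - 1 = 1 ∧ (∀ j, 1 ≤ j → j ≤ k → d (n - j) = 1) ∧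
            1 < d (n - k - 1))) ∧
      -- if there are two, this is the other one
      ((representingMatrices P Q).encard = 2 →
        representingMatrices P Q =
          {toPGL (standardMatrix n d),
            toPGL (-(lowerShear ((-1) ^ (n + 1)) * standardMatrix n d))}) := by
  refine ⟨exists_isSlopeExpansion hne hPQ, fun n d hnd => ?_⟩
  obtain ⟨x, y, g, h, hF, hd0, hQ⟩ := hnd.two_le_and_isRep hPQ
  obtain ⟨hdpos, hdn, -⟩ := hnd
  have hd : ∀ i ≤ n, 0 < d i := fun i hi => by
    rcases Nat.eq_zero_or_pos i with rfl | hi'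
    · omega
    · exact hdpos i hi' hi
  have hd' : ∀ i < n, 0 < d i := fun i hi => hd i hi.le
  obtain ⟨hgh, hg, -⟩ := hF.exists_coords hPQ
  obtain ⟨W, hW⟩ := exists_isIntermediate hgh d
  obtain ⟨j, hj⟩ : ∃ j, d n = j + 1 := ⟨d n - 1, by omega⟩
  -- The parents of `Q`: the previous convergent `L` and the last intermediate convergent `R`.
  obtain ⟨L, hL⟩ : ∃ L, L = W (n + 1) 0 := ⟨_, rfl⟩
  obtain ⟨R, hR⟩ : ∃ R, R = W n j := ⟨_, rfl⟩
  have hLrep : IsRep (conv g h d (n + 1)) L.1 := hL ▸ hW.isRep_conv (n + 1)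
  have hRrep : IsRep ((j : ℤ) • conv g h d (n + 1) + conv g h d n) R.1 := hR ▸ hW n j
  have hmed : IsRep (conv g h d (n + 1) + ((j : ℤ) • conv g h d (n + 1) + conv g h d n)) Q.1 := by
    convert hQ using 1
    rw [conv_add_two, hj]; push_cast; module
  have hlr := isUnit_det2_conv_intermediate hgh d n j
  have hLR : distantGraph.Adj L R := (distant_iff hLrep hRrep).2 hlr
  have hLQ := adj_add_left hlr hLrep hmed
  have hRQ := adj_add_right hlr hRrep hmed
  have hrL : distantGraph.Reachable P L := hL ▸ hW.reachable hgh hg (n + 1)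
  have hcone := not_isRep_cone hgh hg hd' j
  have hlen : ∀ w : distantGraph.Walk P Q, w.length ≠ 0 := fun w hw =>
    hne (SimpleGraph.Walk.eq_of_length_eq_zero hw)
  have hpen : ∀ w : distantGraph.Walk P Q, IsShortest w →
      w.getVert (w.length - 1) = L ∨ w.getVert (w.length - 1) = R := fun w hw =>
    getVert_eq_or_of_isShortest hlr hLrep hRrep hmed hcone hw
  -- The two candidate matrices correspond to the two parents.
  obtain ⟨A, hA⟩ : ∃ A, A = standardMatrix n d := ⟨_, rfl⟩
  obtain ⟨B, hB⟩ : ∃ B, B = -(lowerShear ((-1) ^ (n + 1)) * A) := ⟨_, rfl⟩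
  rw [← hA, ← hB]
  obtain ⟨s, hs, hA0, hA1⟩ := rowVec_prodE_standardCode g h d (n + 1)
  rw [show prodE (standardCode d) (n + 1 + 1) = A from hA.symm] at hA0 hA1
  have hs' : IsUnit (-((-1) ^ (n + 1) * s)) := ((isUnit_one.neg.pow _).mul hs).neg
  have hAQ : IsRep (rowVec g h A 0) Q.1 := hA0 ▸ hQ.smul hs
  have hAL : IsRep (rowVec g h A 1) L.1 := hA1 ▸ hLrep.smul hs'
  have hBQ : IsRep (rowVec g h B 0) Q.1 := by
    rw [hB, rowVec_neg, rowVec_lowerShear_mul_zero]; exact hAQ.neg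
  have hBR : IsRep (rowVec g h B 1) R.1 := by
    convert hRrep.smul hs' using 1
    rw [hB, rowVec_neg, rowVec_lowerShear_mul_one, hA0, hA1, conv_add_two, hj]
    push_cast; module
  have hrepA : ∀ w : distantGraph.Walk P Q, w.getVert (w.length - 1) = L →
      Represents w (toPGL A) := fun w hw =>
    (represents_toPGL_iff hF hPQ (hlen w) hAQ).2 (hw ▸ hAL)
  have hrepB : ∀ w : distantGraph.Walk P Q, w.getVert (w.length - 1) = R →
      Represents w (toPGL B) := fun w hw =>
    (represents_toPGL_iff hF hPQ (hlen w) hBQ).2 (hw ▸ hBR)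
  have hAB : toPGL A ≠ toPGL B := fun hAB =>
    hLR.ne (ProjLine.eq_of_isRep (hAL.rowVec_of_toPGL_eq hAB) hBR)
  have hsub : representingMatrices P Q ⊆ {toPGL A, toPGL B} := by
    rintro M ⟨w, hw, hM⟩
    rcases hpen w hw with h1 | h1
    · exact Or.inl (hM.eq hF hPQ (hlen w) (hrepA w h1))
    · exact Or.inr (hM.eq hF hPQ (hlen w) (hrepB w h1))
  -- Distances from `P` to `L`, `R` and `Q`.
  have hdistQ : distantGraph.dist P Q =
      1 + min (distantGraph.dist P L) (distantGraph.dist P R) :=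
    dist_add_eq hlr hLrep hRrep hmed hcone hrL
  have hdistR : distantGraph.dist P R =
      if j = 1 then 1 + distantGraph.dist P (W n 0) else 1 + distantGraph.dist P L := by
    rw [hR, hL]
    exact hW.dist_eq hgh hg hd' (by omega)
  have hdistL := hW.dist_le_and_le hgh hg hd'
  rw [← hL] at hdistL
  have hdistLR : distantGraph.dist P L ≤ distantGraph.dist P R := by
    split_ifs at hdistR <;> omega
  obtain ⟨wL, hwL, hwL'⟩ := (exists_isShortest_through_iff hLQ hne hrL).2
    (by rw [hdistQ, min_eq_left hdistLR, add_comm])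
  have hdist1 : distantGraph.dist P (W 1 0) = distantGraph.dist P (W 0 0) + 1 := by
    have h1 := hW.adj hgh 0
    rw [hW.zero_eq hg] at h1
    rw [hW.zero_eq hg, SimpleGraph.dist_self]
    exact SimpleGraph.dist_eq_one_iff_adj.2 h1.symm
  have hones := succ_eq_iff_odd_trailing_ones (D := fun i => distantGraph.dist P (W i 0)) (d := d)
    hdist1 hd0 hd' fun i hi => by
      rw [← hW.eq_add_two]
      exact hW.dist_eq hgh hg (fun k hk => hd' k (by omega)) (hd' i hi)
  simp only [← hL] at hones
  have hthroughR : (∃ w : distantGraph.Walk P Q, IsShortest w ∧ w.getVert (w.length - 1) = R) ↔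
      ¬ (2 < d n ∨ d n = 2 ∧ distantGraph.dist P L = distantGraph.dist P (W n 0)) := by
    rw [exists_isShortest_through_iff hRQ hne (hrL.trans hLR.reachable), hdistQ,
      min_eq_left hdistLR]
    split_ifs at hdistR <;> omega
  have hcond : (2 < d n ∨ ∃ k, Odd k ∧ k + 1 ≤ n ∧ d n - 1 = 1 ∧
      (∀ j, 1 ≤ j → j ≤ k → d (n - j) = 1) ∧ 1 < d (n - k - 1)) ↔
      (2 < d n ∨ d n = 2 ∧ distantGraph.dist P L = distantGraph.dist P (W n 0)) := by
    rw [hones]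
    refine or_congr_right ⟨?_, ?_⟩
    · rintro ⟨k, h1, h2, h3, h4, h5⟩
      exact ⟨by omega, k, h1, h2, h4, h5⟩
    · rintro ⟨h3, k, h1, h2, h4, h5⟩
      exact ⟨k, h1, h2, by omega, h4, h5⟩
  refine ⟨fun w hw => ?_, ?_, ⟨wL, hwL, hrepA wL hwL'⟩, ?_, fun hcard => ?_⟩
  · rcases hpen w hw with h1 | h1
    · exact ⟨_, hrepA w h1⟩
    · exact ⟨_, hrepB w h1⟩
  · rw [← Set.encard_pair hAB]
    exact Set.encard_le_encard hsub
  · rw [hcond, ← not_iff_not, ← hthroughR]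
    constructor
    · intro hnot
      by_contra hR'
      refine hnot ⟨toPGL A, fun w hw => ?_, fun M hM => ?_⟩
      · exact hrepA w ((hpen w hw).resolve_right fun h1 => hR' ⟨w, hw, h1⟩)
      · exact (hM wL hwL).eq hF hPQ (hlen wL) (hrepA wL hwL')
    · rintro ⟨wR, hwR, hwR'⟩ ⟨M, hM, -⟩
      exact hAB (((hM wL hwL).eq hF hPQ (hlen wL) (hrepA wL hwL')).symm.trans
        ((hM wR hwR).eq hF hPQ (hlen wR) (hrepB wR hwR')))
  · refine ((Set.toFinite _).subset hsub).eq_of_subset_of_encard_le hsub ?_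
    rw [hcard, Set.encard_pair hAB]
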